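/- Let $K$ be a field of characteristic zero, $n\ge 0$, and let $A_n$ be the $n$-th Weyl algebra over $K$, i.e. the algebra of differential operators on $K[x_1,\dots,x_n]$, generated by $x_1,\dots,x_n$ and $\partial_i=\partial/\partial x_i$ ($i=1,\dots,n$). The elements $x^\alpha\partial^\beta$ with $\alpha,\beta\in\mathbb N^n$ form a $K$-basis of $A_n$; for a nonzero $a=\sum\lambda_{\alpha\beta}x^\alpha\partial^\beta\in A_n$ put $\deg(a)=\max\{|\alpha|+|\beta| : \lambda_{\alpha\beta}\neq 0\}$. For a $K$-algebra endomorphism $\sigma$ of $A_n$ put $\deg(\sigma)=\max\{\deg\sigma(x_i),\deg\sigma(\partial_i) : i=1,\dots,n\}$ (read as $0$ if $n=0$). Theorem. Let $\sigma$ be a $K$-algebra endomorphism of $A_n$ and $d=\deg(\sigma)$. Then $A_n$, regarded as a $\sigma(A_n)$-bimodule by left and right multiplication (equivalently, as a left module over $\sigma(A_n)\otimes_K\sigma(A_n)^{\mathrm{op}}\cong A_{2n}$), has finite length, and its length is at most $d^{2n}$. -/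

import Mathlib

open scoped TensorProduct

noncomputable section

namespace Weyl

variable (K : Type*) [Field K] (n : ℕ)

/-- Multiplication by the variable `x_i`, as an operator on `K[x_1, …, x_n]`. -/
def xOp (i : Fin n) : Module.End K (MvPolynomial (Fin n) K) :=
  LinearMap.mulLeft K (MvPolynomial.X i)

/-- The partial derivative `∂_i = ∂/∂x_i`, as an operator on `K[x_1, …, x_n]`. -/
def dOp (i : Fin n) : Module.End K (MvPolynomial (Fin n) K) :=
  (MvPolynomial.pderiv i).toLinearMap

/-- The algebra of operators on `K[x_1, …, x_n]` generated by the multiplications `x_i` and the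
partial derivatives `∂_i`; for `K` of characteristic zero this is the ring of differential
operators on the polynomial algebra. -/
def weylSubalgebra : Subalgebra K (Module.End K (MvPolynomial (Fin n) K)) :=
  Algebra.adjoin K (Set.range (xOp K n) ∪ Set.range (dOp K n))

/-- The `n`-th Weyl algebra `A_n` over `K`. -/
def WeylAlgebra : Type _ := ↥(weylSubalgebra K n)

instance : Ring (WeylAlgebra K n) := inferInstanceAs (Ring ↥(weylSubalgebra K n))

instance : Algebra K (WeylAlgebra K n) := inferInstanceAs (Algebra K ↥(weylSubalgebra K n))

variable {K n}

/-- The inclusion of `A_n` into the algebra of all operators on `K[x_1, …, x_n]`. -/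
def toEnd : WeylAlgebra K n →ₐ[K] Module.End K (MvPolynomial (Fin n) K) :=
  (weylSubalgebra K n).val

theorem toEnd_injective : Function.Injective (toEnd (K := K) (n := n)) :=
  Subtype.val_injective

/-- The generator `x_i` of `A_n`. -/
def x (i : Fin n) : WeylAlgebra K n :=
  ⟨xOp K n i, Algebra.subset_adjoin (Or.inl ⟨i, rfl⟩)⟩

/-- The generator `∂_i` of `A_n`. -/
def d (i : Fin n) : WeylAlgebra K n :=
  ⟨dOp K n i, Algebra.subset_adjoin (Or.inr ⟨i, rfl⟩)⟩

variable (K)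

/-- `x^α = x_1^{α_1} ⋯ x_n^{α_n}`. -/
def xPow (α : Fin n →₀ ℕ) : WeylAlgebra K n :=
  ((List.finRange n).map fun i => x i ^ α i).prod

/-- `∂^β = ∂_1^{β_1} ⋯ ∂_n^{β_n}`. -/
def dPow (β : Fin n →₀ ℕ) : WeylAlgebra K n :=
  ((List.finRange n).map fun i => d i ^ β i).prod

/-- The monomial `x^α ∂^β`, where `p = (α, β)`. -/
def xdMonomial (p : (Fin n →₀ ℕ) × (Fin n →₀ ℕ)) : WeylAlgebra K n :=
  xPow K p.1 * dPow K p.2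

variable {K}

open MvPolynomial in
theorem coe_x_apply (i : Fin n) (p : MvPolynomial (Fin n) K) :
    toEnd (x i : WeylAlgebra K n) p = X i * p := rfl

open MvPolynomial in
theorem coe_d_apply (i : Fin n) (p : MvPolynomial (Fin n) K) :
    toEnd (d i : WeylAlgebra K n) p = pderiv i p := rfl

open MvPolynomial in
theorem coe_x_pow_apply (i : Fin n) (k : ℕ) (p : MvPolynomial (Fin n) K) :
    toEnd ((x i : WeylAlgebra K n) ^ k) p = X i ^ k * p := by
  induction k generalizing p with
  | zero => simp
  | succ k ih =>
    have : toEnd ((x i : WeylAlgebra K n) ^ (k + 1)) p = toEnd (x i ^ k) (toEnd (x i) p) := by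
      rw [pow_succ]; rfl
    rw [this, ih, coe_x_apply]; ring

open MvPolynomial in
theorem coe_xPow_apply (α : Fin n →₀ ℕ) (p : MvPolynomial (Fin n) K) :
    toEnd (xPow K α) p = monomial α 1 * p := by
  have key : ∀ (l : List (Fin n)) (p : MvPolynomial (Fin n) K),
      toEnd ((l.map fun i => (x i : WeylAlgebra K n) ^ α i).prod) p
        = (l.map fun i => (X i : MvPolynomial (Fin n) K) ^ α i).prod * p := by
    intro l
    induction l with
    | nil => intro p; simp
    | cons i l ih =>
      intro p
      have : toEnd (((i :: l).map fun i => (x i : WeylAlgebra K n) ^ α i).prod) p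
          = toEnd (x i ^ α i) (toEnd ((l.map fun i => (x i : WeylAlgebra K n) ^ α i).prod) p) := by
        rw [List.map_cons, List.prod_cons]; rfl
      rw [this, ih, coe_x_pow_apply, List.map_cons, List.prod_cons, mul_assoc]
  rw [xPow, key, monomial_eq, Finsupp.prod_fintype _ _ (by simp), ← List.ofFn_eq_map,
    List.prod_ofFn]
  simp

open MvPolynomial in
theorem coe_d_pow_monomial (i : Fin n) (k : ℕ) (γ : Fin n →₀ ℕ) (c : K) :
    toEnd ((d i : WeylAlgebra K n) ^ k) (monomial γ c)
      = monomial (γ - Finsupp.single i k) (c * ((γ i).descFactorial k : K)) := by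
  induction k with
  | zero => simp
  | succ k ih =>
    have : toEnd ((d i : WeylAlgebra K n) ^ (k + 1)) (monomial γ c)
        = toEnd (d i) (toEnd (d i ^ k) (monomial γ c)) := by
      rw [pow_succ']; rfl
    rw [this, ih, coe_d_apply, pderiv_monomial, tsub_tsub, ← Finsupp.single_add,
      Nat.descFactorial_succ]
    congr 1
    simp only [Finsupp.coe_tsub, Pi.sub_apply, Finsupp.single_eq_same, Nat.cast_mul]
    ring

open MvPolynomial in
theorem coe_dPow_monomial (β γ : Fin n →₀ ℕ) (c : K) :
    toEnd (dPow K β) (monomial γ c)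
      = monomial (γ - β) (c * ∏ i, ((γ i).descFactorial (β i) : K)) := by
  have key : ∀ (l : List (Fin n)), l.Nodup →
      toEnd ((l.map fun i => (d i : WeylAlgebra K n) ^ β i).prod) (monomial γ c)
        = monomial (γ - ∑ i ∈ l.toFinset, Finsupp.single i (β i))
          (c * ∏ i ∈ l.toFinset, ((γ i).descFactorial (β i) : K)) := by
    intro l
    induction l with
    | nil => intro _; simp
    | cons i l ih =>
      intro h
      rw [List.nodup_cons] at h
      have hi : i ∉ l.toFinset := by simpa using h.1
      have : toEnd (((i :: l).map fun i => (d i : WeylAlgebra K n) ^ β i).prod) (monomial γ c)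
          = toEnd (d i ^ β i)
            (toEnd ((l.map fun i => (d i : WeylAlgebra K n) ^ β i).prod) (monomial γ c)) := by
        rw [List.map_cons, List.prod_cons]; rfl
      have h0 : (∑ j ∈ l.toFinset, Finsupp.single j (β j)) i = 0 := by
        rw [Finsupp.finsetSum_apply]
        refine Finset.sum_eq_zero fun j hj => ?_
        rw [Finsupp.single_apply, if_neg]
        rintro rfl; exact hi hj
      rw [this, ih h.2, coe_d_pow_monomial, List.toFinset_cons, Finset.sum_insert hi,
        Finset.prod_insert hi, tsub_tsub, add_comm (Finsupp.single i (β i)), Finsupp.tsub_apply,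
        h0, tsub_zero]
      congr 1
      ring
  have hl : (List.finRange n).toFinset = Finset.univ := by ext; simp
  rw [dPow, key _ (List.nodup_finRange n), hl, Finsupp.univ_sum_single]

theorem weyl_ext {a b : WeylAlgebra K n}
    (h : ∀ γ : Fin n →₀ ℕ,
      toEnd a (MvPolynomial.monomial γ 1) = toEnd b (MvPolynomial.monomial γ 1)) :
    a = b := by
  apply toEnd_injective
  refine (MvPolynomial.basisMonomials (Fin n) K).ext fun γ => ?_
  rw [MvPolynomial.coe_basisMonomials]
  exact h γ

theorem x_mul_xPow (i : Fin n) (α : Fin n →₀ ℕ) :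
    x i * xPow K α = xPow K (Finsupp.single i 1 + α) := by
  refine toEnd_injective (LinearMap.ext fun p => ?_)
  change toEnd (x i) (toEnd (xPow K α) p) = _
  rw [coe_xPow_apply, coe_x_apply, coe_xPow_apply, ← mul_assoc, MvPolynomial.X,
    MvPolynomial.monomial_mul, one_mul]

theorem d_mul_xPow (i : Fin n) (α : Fin n →₀ ℕ) :
    d i * xPow K α = xPow K α * d i + (α i : K) • xPow K (α - Finsupp.single i 1) := by
  refine toEnd_injective (LinearMap.ext fun p => ?_)
  change toEnd (d i) (toEnd (xPow K α) p) = toEnd (xPow K α) (toEnd (d i) p)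
    + (α i : K) • toEnd (xPow K (α - Finsupp.single i 1)) p
  rw [coe_xPow_apply, coe_d_apply, coe_xPow_apply, coe_d_apply, coe_xPow_apply, Derivation.leibniz,
    MvPolynomial.pderiv_monomial, smul_eq_mul, smul_eq_mul, one_mul, ← smul_mul_assoc,
    MvPolynomial.smul_monomial, smul_eq_mul, mul_one]
  ring

theorem d_mul_dPow (i : Fin n) (β : Fin n →₀ ℕ) :
    d i * dPow K β = dPow K (β + Finsupp.single i 1) := by
  refine weyl_ext fun γ => ?_
  change toEnd (d i) (toEnd (dPow K β) _) = _
  rw [coe_dPow_monomial, coe_dPow_monomial, coe_d_apply, MvPolynomial.pderiv_monomial, tsub_tsub]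
  congr 1
  rw [one_mul, one_mul, ← Finset.mul_prod_erase _ _ (Finset.mem_univ i),
    ← Finset.mul_prod_erase _ _ (Finset.mem_univ i)]
  have : ∀ j ∈ Finset.univ.erase i, (((γ j).descFactorial ((β + Finsupp.single i 1 : Fin n →₀ ℕ) j) : ℕ) : K)
      = ((γ j).descFactorial (β j) : K) := by
    intro j hj
    have : j ≠ i := Finset.ne_of_mem_erase hj
    simp [this]
  rw [Finset.prod_congr rfl this]
  simp only [Finsupp.coe_add, Pi.add_apply, Finsupp.single_eq_same, Nat.descFactorial_succ,
    Nat.cast_mul, Finsupp.coe_tsub, Pi.sub_apply]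
  ring

theorem xdMonomial_span :
    ⊤ ≤ Submodule.span K (Set.range (xdMonomial K (n := n))) := by
  set S := Submodule.span K (Set.range (xdMonomial K (n := n))) with hS
  have mem (α β : Fin n →₀ ℕ) : xPow K α * dPow K β ∈ S := Submodule.subset_span ⟨(α, β), rfl⟩
  have step (a : WeylAlgebra K n) (h : ∀ p, a * xdMonomial K p ∈ S) : ∀ s ∈ S, a * s ∈ S := by
    intro s hs
    induction hs using Submodule.span_induction with
    | mem y hy => obtain ⟨p, rfl⟩ := hy; exact h p
    | zero => rw [mul_zero]; exact S.zero_mem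
    | add y z _ _ hy hz => rw [mul_add]; exact S.add_mem hy hz
    | smul c y _ hy => rw [mul_smul_comm]; exact S.smul_mem c hy
  let mk (a : Module.End K (MvPolynomial (Fin n) K)) (ha : a ∈ weylSubalgebra K n) :
    WeylAlgebra K n := ⟨a, ha⟩
  have all : ∀ (a : Module.End K (MvPolynomial (Fin n) K)) (ha : a ∈ weylSubalgebra K n),
      ∀ s ∈ S, mk a ha * s ∈ S := by
    intro a ha
    induction ha using Algebra.adjoin_induction with
    | mem a ha =>
      rcases ha with ⟨i, rfl⟩ | ⟨i, rfl⟩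
      · refine step (x i) fun p => ?_
        rw [xdMonomial, ← mul_assoc, x_mul_xPow]
        exact mem _ _
      · refine step (d i) fun p => ?_
        rw [xdMonomial, ← mul_assoc, d_mul_xPow, add_mul, mul_assoc, d_mul_dPow, smul_mul_assoc]
        exact S.add_mem (mem _ _) (S.smul_mem _ (mem _ _))
    | algebraMap r =>
      intro s hs
      have : mk (algebraMap K _ r) ((weylSubalgebra K n).algebraMap_mem r) * s
          = r • s := (Algebra.smul_def r s).symm
      exact this ▸ S.smul_mem r hs
    | add a b ha hb iha ihb =>
      intro s hs
      have : mk (a + b) ((weylSubalgebra K n).add_mem ha hb) * s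
          = mk a ha * s + mk b hb * s :=
        add_mul (mk a ha) (mk b hb) s
      exact this ▸ S.add_mem (iha s hs) (ihb s hs)
    | mul a b ha hb iha ihb =>
      intro s hs
      have : mk (a * b) ((weylSubalgebra K n).mul_mem ha hb) * s
          = mk a ha * (mk b hb * s) :=
        mul_assoc (mk a ha) (mk b hb) s
      exact this ▸ iha _ (ihb s hs)
  have one : (1 : WeylAlgebra K n) ∈ S := by
    have := mem 0 0
    simpa [xPow, dPow] using this
  intro a _
  have h := all (toEnd a) a.2 1 one
  rw [mul_one] at h
  exact h

theorem xdMonomial_linearIndependent [CharZero K] :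
    LinearIndependent K (xdMonomial K (n := n)) := by
  rw [linearIndependent_iff]
  intro c hc
  by_contra hne
  have hsupp : c.support.Nonempty := Finsupp.support_nonempty_iff.mpr hne
  obtain ⟨⟨α, β⟩, hp, hmin⟩ := c.support.exists_min_image (fun p => p.2.degree) hsupp
  have happ : (c.sum fun p r => r • toEnd (xdMonomial K p) (MvPolynomial.monomial β 1)) = 0 := by
    have h := congrArg (fun a : WeylAlgebra K n => toEnd a (MvPolynomial.monomial β 1)) hc
    simpa [Finsupp.linearCombination_apply, Finsupp.sum] using h
  have hco := congrArg (MvPolynomial.coeff α) happ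
  rw [Finsupp.sum, MvPolynomial.coeff_sum, MvPolynomial.coeff_zero] at hco
  have hval : ∀ p : (Fin n →₀ ℕ) × (Fin n →₀ ℕ), toEnd (xdMonomial K p) (MvPolynomial.monomial β 1)
      = MvPolynomial.monomial (p.1 + (β - p.2)) (∏ i, ((β i).descFactorial (p.2 i) : K)) := by
    intro p
    change toEnd (xPow K p.1) (toEnd (dPow K p.2) _) = _
    rw [coe_dPow_monomial, coe_xPow_apply, MvPolynomial.monomial_mul, one_mul, one_mul]
  rw [Finset.sum_eq_single_of_mem _ hp] at hco
  · rw [hval, MvPolynomial.coeff_smul, MvPolynomial.coeff_monomial] at hco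
    simp only [tsub_self, add_zero, if_true, Nat.descFactorial_self, smul_eq_mul] at hco
    rcases mul_eq_zero.mp hco with h | h
    · exact (Finsupp.mem_support_iff.mp hp) h
    · obtain ⟨i, _, hi⟩ := Finset.prod_eq_zero_iff.mp h
      exact Nat.factorial_ne_zero _ (by exact_mod_cast hi)
  · intro q hq hqne
    rw [hval, MvPolynomial.coeff_smul, MvPolynomial.coeff_monomial]
    by_cases hle : q.2 ≤ β
    · have hdeg : β.degree ≤ q.2.degree := hmin q hq
      have heq : q.2 = β := by
        have h1 : (β - q.2) + q.2 = β := tsub_add_cancel_of_le hle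
        have h2 : (β - q.2).degree + q.2.degree = β.degree := by rw [← map_add, h1]
        have h3 : (β - q.2).degree = 0 := by omega
        rw [Finsupp.degree_eq_zero_iff] at h3
        rw [h3, zero_add] at h1
        exact h1
      have hq1 : q.1 ≠ α := fun h => hqne (Prod.ext h heq)
      rw [if_neg (by rw [heq, tsub_self, add_zero]; exact hq1), smul_zero]
    · have : ∃ i, β i < q.2 i := by
        by_contra! h
        exact hle h
      obtain ⟨i, hi⟩ := this
      rw [Finset.prod_eq_zero (Finset.mem_univ i)
        (by rw [Nat.descFactorial_of_lt hi, Nat.cast_zero])]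
      simp

variable (K n) in
/-- The `K`-basis `x^α ∂^β` (`α, β ∈ ℕⁿ`) of the Weyl algebra. -/
def xdBasis [CharZero K] :
    Module.Basis ((Fin n →₀ ℕ) × (Fin n →₀ ℕ)) K (WeylAlgebra K n) :=
  Module.Basis.mk xdMonomial_linearIndependent xdMonomial_span

/-- The degree of `a = ∑ λ_{αβ} x^α ∂^β`: the maximum of `|α| + |β|` over all `(α, β)` with
`λ_{αβ} ≠ 0`, and `⊥ = -∞` for `a = 0`. -/
def deg [CharZero K] (a : WeylAlgebra K n) : WithBot ℕ :=
  ((xdBasis K n).repr a).support.sup fun p => ((p.1.degree + p.2.degree : ℕ) : WithBot ℕ)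

/-- The degree of an endomorphism `σ` of `A_n`: the maximum of the degrees of the elements `σ(x_i)`
and `σ(∂_i)` (which are all nonzero), understood as `0` if `n = 0`. -/
def endDeg [CharZero K] (σ : WeylAlgebra K n →ₐ[K] WeylAlgebra K n) : ℕ :=
  (Finset.univ.sup fun i : Fin n => deg (σ (x i)) ⊔ deg (σ (d i))).unbotD 0

attribute [local instance] TensorProduct.Algebra.module in
/-- The length of a `K`-algebra `A` as a bimodule over a subalgebra `B`, that is, as a left module
over `B ⊗ Bᵒᵖ`, where `(b ⊗ b') • a = b * a * b'`. -/
def bimoduleLength {A : Type*} [Ring A] [Algebra K A] (B : Subalgebra K A) : ℕ∞ :=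
  Module.length (B ⊗[K] B.op) A

end Weyl

end

/-!
Let `B` be the image of `σ`. The bimodule `A_n` is acted on by `4n` operators, the left and right
multiplications by the `σ(x_i)` and `σ(∂_i)`. Their commutators are scalars and form a nondegenerate
form (`Weyl.isWeylFamily_bimoduleGenerator`), and each of them raises the degree of an element of
`A_n` by at most `d = deg σ`. The theorem is a comparison of growth rates with respect to the degree.

The lower bound on growth: let `r` be a family of `2m` elements with scalar commutators and
nondegenerate commutator form, acting on a module with a nonzero vector `v`, and let `F_i` be the
span of the `r^c • v` for the ordered monomials `r^c` of degree at most `i`. Then `dim F_i` is at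
least the number of exponents of degree at most `i` in `m` variables
(`card_boundedExponents_le_finrank`). Two facts give this without Hilbert polynomials.
* Bernstein's inequality (`card_boundedExponents_le_finrank_mul`): the `r^c` with `|c| ≤ i` are
  linearly independent as maps `F_i → F_{2i}`, because commutators differentiate ordered monomials
  and the characteristic is zero. Hence `dim F_i * dim F_{2i}` grows at least like `i ^ (2m)`.
* With respect to a degree-compatible monomial order, `dim F_i` counts the elements of degree at most
  `i` in the set of standard exponents, those `c` for which `r^c • v` is not a combination of earlier
  vectors. This set is closed under divisors (`isLowerSet_standardExponents`). Either it contains a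
  coordinate subspace of dimension `m`, which is the claim, or all its elements have fewer than `m`
  large coordinates (`exists_bound_of_isLowerSet`); then `dim F_i = O(i ^ (m - 1))`, which
  contradicts Bernstein's inequality.

Given a chain of `k` strict inclusions of sub-bimodules of `A_n`, the lower bound (for `m = 2n`)
applies to a vector in each successive quotient. Adding up inside the elements of degree at most
`s + d * i`, where `s` bounds the degrees of the chosen vectors, yields `k * i ^ (2n) / (2n)!` as the
leading term of a lower bound for the number of monomials `x^α ∂^β` of degree at most `s + d * i`,
which is `(d * i) ^ (2n) / (2n)!` to leading order. So `k ≤ d ^ (2n)`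
(`length_le_pow_of_filtration`).
-/

/-! ### Counting exponents of bounded degree -/

/-- The exponents of total degree at most `i`. -/
noncomputable def boundedExponents (ι : Type*) [Finite ι] (i : ℕ) : Finset (ι →₀ ℕ) :=
  (Finsupp.finite_of_degree_le (σ := ι) i).toFinset

@[simp]
theorem mem_boundedExponents {ι : Type*} [Finite ι] {i : ℕ} {c : ι →₀ ℕ} :
    c ∈ boundedExponents ι i ↔ c.degree ≤ i := by
  simp [boundedExponents]

theorem sum_range_multichoose (m i : ℕ) :
    ∑ k ∈ Finset.range (i + 1), m.multichoose k = (m + 1).multichoose i := by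
  induction i with
  | zero => simp
  | succ i ih => rw [Finset.sum_range_succ, ih, Nat.multichoose_succ_succ, add_comm]

theorem card_boundedExponents (ι : Type*) [Fintype ι] (i : ℕ) :
    (boundedExponents ι i).card = (i + Fintype.card ι).choose (Fintype.card ι) := by
  classical
  have h1 : ∀ c ∈ boundedExponents ι i, c.degree ∈ Finset.range (i + 1) := fun c hc => by
    simpa [Nat.lt_succ_iff] using hc
  rw [Finset.card_eq_sum_card_fiberwise h1]
  have h2 : ∀ k ∈ Finset.range (i + 1),
      ((boundedExponents ι i).filter fun c => c.degree = k).card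
        = (Fintype.card ι).multichoose k := by
    intro k hk
    rw [← Finset.card_univ, ← Finset.card_finsuppAntidiag_nat_eq_multichoose]
    congr 1
    ext c
    simp only [Finset.mem_filter, mem_boundedExponents, Finset.mem_finsuppAntidiag,
      Finset.subset_univ, and_true, Finsupp.degree_eq_sum]
    rw [Finset.mem_range] at hk
    constructor
    · exact fun h => h.2
    · exact fun h => ⟨h.trans_le (Nat.lt_succ_iff.mp hk), h⟩
  rw [Finset.sum_congr rfl h2, sum_range_multichoose, Nat.multichoose_eq]
  have : Fintype.card ι + 1 + i - 1 = i + Fintype.card ι := by omega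
  rw [this, ← Nat.choose_symm_add]

theorem pow_le_card_boundedExponents (ι : Type*) [Fintype ι] (i : ℕ) :
    (i + 1) ^ Fintype.card ι ≤ (boundedExponents ι i).card * (Fintype.card ι).factorial := by
  rw [card_boundedExponents, mul_comm, ← Nat.descFactorial_eq_factorial_mul_choose]
  refine le_trans ?_ (Nat.pow_sub_le_descFactorial _ _)
  exact Nat.pow_le_pow_left (by omega) _

theorem card_boundedExponents_le_pow (ι : Type*) [Fintype ι] (i : ℕ) :
    (boundedExponents ι i).card * (Fintype.card ι).factorial
      ≤ (i + Fintype.card ι) ^ Fintype.card ι := by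
  rw [card_boundedExponents, mul_comm, ← Nat.descFactorial_eq_factorial_mul_choose]
  exact Nat.descFactorial_le_pow _ _

/-- Letting the scale `t` tend to infinity compares the leading coefficients. -/
theorem le_pow_of_forall_mul_pow_le {k d q m : ℕ}
    (h : ∀ t : ℕ, 0 < t → k * t ^ m ≤ (d * t + q) ^ m) : k ≤ d ^ m := by
  have lim : Filter.Tendsto (fun t : ℕ => ((d : ℝ) + q / (t : ℝ)) ^ m) Filter.atTop
      (nhds (((d : ℝ) + 0) ^ m)) :=
    ((tendsto_const_div_atTop_nhds_zero_nat (q : ℝ)).const_add _).pow _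
  have : (k : ℝ) ≤ ((d : ℝ) + 0) ^ m := by
    refine ge_of_tendsto lim ?_
    filter_upwards [Filter.eventually_gt_atTop 0] with t ht
    have ht' : (0 : ℝ) < t := by exact_mod_cast ht
    have h1 : (k : ℝ) * (t : ℝ) ^ m ≤ ((d : ℝ) * t + q) ^ m := by exact_mod_cast h t ht
    have h2 : (d : ℝ) + q / (t : ℝ) = (d * t + q) / t := by field_simp
    rw [h2, div_pow, le_div_iff₀ (by positivity)]
    exact h1
  rw [add_zero] at this
  exact_mod_cast this

/-- In a down-closed set `C` of exponents that contains no coordinate subspace of dimension `m`,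
every exponent has fewer than `m` large coordinates, with a uniform notion of large. -/
theorem exists_bound_of_isLowerSet {ι : Type*} [Fintype ι] {C : Set (ι →₀ ℕ)}
    (hC : IsLowerSet C) (m : ℕ)
    (h : ∀ S : Finset ι, S.card = m → ∃ c : ι →₀ ℕ, c.support ⊆ S ∧ c ∉ C) :
    ∃ N, 0 < N ∧ ∀ c ∈ C, (Finset.univ.filter fun j => N ≤ c j).card < m := by
  classical
  choose! b hb hbC using h
  -- An exponent whose coordinates in some `S` are all at least `N` is divisible by `b S`.
  set N := (Finset.univ.sup fun S : Finset ι => (b S).degree) + 1 with hN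
  refine ⟨N, Nat.succ_pos _, fun c hc => ?_⟩
  by_contra! hm
  obtain ⟨S, hS, hcard⟩ := Finset.exists_subset_card_eq hm
  refine hbC S hcard (hC (fun j => ?_) hc)
  by_cases hj : j ∈ S
  · have h1 : N ≤ c j := by simpa using hS hj
    have h2 : (b S).degree ≤ Finset.univ.sup fun S : Finset ι => (b S).degree :=
      Finset.le_sup (f := fun S : Finset ι => (b S).degree) (Finset.mem_univ S)
    have h3 : b S j ≤ (b S).degree := Finsupp.le_degree j (b S)
    omega
  · have : b S j = 0 := by
      by_contra h0
      exact hj (hb S hcard (Finsupp.mem_support_iff.mpr h0))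
    omega

/-- Exponents of degree at most `i` with at most `m` coordinates that are `≥ N` are `O(i ^ m)` in
number. -/
theorem card_le_of_few_large {ι : Type*} [Fintype ι] {m N i : ℕ} (hN : 0 < N)
    (s : Finset (ι →₀ ℕ)) (hi : ∀ c ∈ s, c.degree ≤ i)
    (hs : ∀ c ∈ s, (Finset.univ.filter fun j => N ≤ c j).card ≤ m) :
    s.card ≤ 2 ^ Fintype.card ι * N ^ Fintype.card ι * (i + 1) ^ m := by
  classical
  -- `P T` bounds the exponents whose large coordinates are those in `T`.
  let P : Finset ι → Finset (ι → ℕ) := fun T =>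
    Fintype.piFinset fun j => if j ∈ T then Finset.range (i + 1) else Finset.range N
  let 𝒯 := (Finset.univ : Finset (Finset ι)).filter fun T => T.card ≤ m
  have hsub : s.card ≤ (𝒯.biUnion P).card := by
    refine Finset.card_le_card_of_injOn (fun c => (c : ι → ℕ)) (fun c hc => ?_)
      (fun _ _ _ _ h => DFunLike.coe_injective h)
    simp only [Finset.coe_biUnion, Set.mem_iUnion, Finset.mem_coe]
    refine ⟨Finset.univ.filter fun j => N ≤ c j, by simpa [𝒯] using hs c hc, ?_⟩
    simp only [P, Fintype.mem_piFinset, Finset.mem_filter, Finset.mem_univ, true_and]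
    intro j
    have := (Finsupp.le_degree j c).trans (hi c hc)
    split_ifs with h
    · exact Finset.mem_range.mpr (by omega)
    · exact Finset.mem_range.mpr (by omega)
  have hP : ∀ T ∈ 𝒯, (P T).card ≤ N ^ Fintype.card ι * (i + 1) ^ m := by
    intro T hT
    have hT' : T.card ≤ m := by simpa [𝒯] using hT
    rw [Fintype.card_piFinset]
    calc ∏ j, (if j ∈ T then Finset.range (i + 1) else Finset.range N).card
        ≤ ∏ j, N * (if j ∈ T then i + 1 else 1) := by
          refine Finset.prod_le_prod' fun j _ => ?_
          split_ifs
          · rw [Finset.card_range]; exact Nat.le_mul_of_pos_left _ hN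
          · rw [Finset.card_range, mul_one]
      _ = N ^ Fintype.card ι * (i + 1) ^ T.card := by
          rw [Finset.prod_mul_distrib, Finset.prod_const, Finset.card_univ, Finset.prod_ite_mem,
            Finset.univ_inter, Finset.prod_const]
      _ ≤ _ := Nat.mul_le_mul_left _ (Nat.pow_le_pow_right (Nat.succ_pos i) hT')
  calc s.card ≤ (𝒯.biUnion P).card := hsub
    _ ≤ 𝒯.card * (N ^ Fintype.card ι * (i + 1) ^ m) := Finset.card_biUnion_le_card_mul _ _ _ hP
    _ ≤ 2 ^ Fintype.card ι * (N ^ Fintype.card ι * (i + 1) ^ m) := by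
        refine Nat.mul_le_mul_right _ ?_
        refine (Finset.card_le_univ _).trans ?_
        rw [Fintype.card_finset]
    _ = _ := by ring

/-! ### Ordered monomials -/

section OrderedMonomial

variable {K R ι : Type*} [Field K] [Ring R] [Algebra K R]

/-- The product of the powers `r j ^ c j`, in the order in which the `j` occur in `l`. -/
def orderedMonomial (r : ι → R) (l : List ι) (c : ι →₀ ℕ) : R :=
  (l.map fun j => r j ^ c j).prod

theorem orderedMonomial_cons (r : ι → R) (k : ι) (l : List ι) (c : ι →₀ ℕ) :
    orderedMonomial r (k :: l) c = r k ^ c k * orderedMonomial r l c := by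
  simp [orderedMonomial]

theorem orderedMonomial_congr (r : ι → R) {l : List ι} {c c' : ι →₀ ℕ}
    (h : ∀ j ∈ l, c j = c' j) : orderedMonomial r l c = orderedMonomial r l c' := by
  unfold orderedMonomial
  congr 1
  exact List.map_congr_left fun j hj => by rw [h j hj]

theorem mul_pow_of_commutator {z y : R} {a : K} (h : z * y = y * z + a • 1) (k : ℕ) :
    z * y ^ k = y ^ k * z + (a * k) • y ^ (k - 1) := by
  induction k with
  | zero => simp
  | succ k ih =>
    rw [pow_succ, ← mul_assoc, ih, add_mul, mul_assoc, h, smul_mul_assoc]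
    rcases k with _ | k
    · simp
    · rw [Nat.succ_sub_one, Nat.succ_sub_one, ← pow_succ, mul_add, mul_smul_comm, mul_one, add_assoc,
        ← add_smul, ← mul_assoc]
      congr 2
      push_cast
      ring

/-- An element whose commutators with the `r k` are scalars acts on ordered monomials by a
derivation. -/
theorem mul_orderedMonomial [DecidableEq ι] (r : ι → R) {z : R} {ω : ι → K}
    (h : ∀ k, z * r k = r k * z + ω k • 1) {l : List ι} (hl : l.Nodup) (c : ι →₀ ℕ) :
    z * orderedMonomial r l c = orderedMonomial r l c * z
      + ∑ k ∈ l.toFinset, (ω k * c k) • orderedMonomial r l (c - Finsupp.single k 1) := by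
  induction l with
  | nil => simp [orderedMonomial]
  | cons k l ih =>
    rw [List.nodup_cons] at hl
    have hk : k ∉ l.toFinset := by simpa using hl.1
    rw [List.toFinset_cons, Finset.sum_insert hk, orderedMonomial_cons, ← mul_assoc,
      mul_pow_of_commutator (h k), add_mul, mul_assoc, ih hl.2, mul_add, smul_mul_assoc,
      Finset.mul_sum]
    have h1 : r k ^ (c k - 1) * orderedMonomial r l c
        = orderedMonomial r (k :: l) (c - Finsupp.single k 1) := by
      rw [orderedMonomial_cons, orderedMonomial_congr r (c := c - Finsupp.single k 1) (c' := c)]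
      · simp
      · intro j hj
        have : k ≠ j := by rintro rfl; exact hl.1 hj
        simp [this]
    have h2 : ∀ j ∈ l.toFinset, r k ^ c k * (ω j * c j) • orderedMonomial r l (c - Finsupp.single j 1)
        = (ω j * c j) • orderedMonomial r (k :: l) (c - Finsupp.single j 1) := by
      intro j hj
      have : j ≠ k := by rintro rfl; exact hk hj
      rw [orderedMonomial_cons, mul_smul_comm]
      simp [this]
    rw [h1, Finset.sum_congr rfl h2, mul_assoc]
    abel

/-- Multiplying an ordered monomial by a generator raises the corresponding exponent, up to
ordered monomials of smaller degree. -/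
theorem generator_mul_orderedMonomial [DecidableEq ι] (r : ι → R)
    (h : ∀ j k, ∃ a : K, r j * r k = r k * r j + a • 1) {l : List ι} (hl : l.Nodup) (c : ι →₀ ℕ)
    {j : ι} (hj : j ∈ l) :
    ∃ b : ι → K, r j * orderedMonomial r l c = orderedMonomial r l (c + Finsupp.single j 1)
      + ∑ k ∈ l.toFinset, b k • orderedMonomial r l (c - Finsupp.single k 1) := by
  induction l with
  | nil => simp at hj
  | cons k l ih =>
    rw [List.nodup_cons] at hl
    have hk : k ∉ l.toFinset := by simpa using hl.1
    by_cases hjk : j = k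
    · subst hjk
      refine ⟨0, ?_⟩
      rw [orderedMonomial_cons, orderedMonomial_cons, ← mul_assoc, ← pow_succ',
        orderedMonomial_congr r (l := l) (c := c + Finsupp.single j 1) (c' := c)]
      · simp
      · intro i hi
        have : j ≠ i := by rintro rfl; exact hl.1 hi
        simp [this]
    · have hjl : j ∈ l := by simpa [hjk] using hj
      obtain ⟨b, hb⟩ := ih hl.2 hjl
      obtain ⟨a, ha⟩ := h j k
      refine ⟨fun i => if i = k then a * c k else b i, ?_⟩
      rw [List.toFinset_cons, Finset.sum_insert hk, orderedMonomial_cons, ← mul_assoc,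
        mul_pow_of_commutator ha, add_mul, mul_assoc, hb, mul_add, smul_mul_assoc,
        Finset.mul_sum]
      have h1 : r k ^ (c k - 1) * orderedMonomial r l c
          = orderedMonomial r (k :: l) (c - Finsupp.single k 1) := by
        rw [orderedMonomial_cons, orderedMonomial_congr r (c := c - Finsupp.single k 1) (c' := c)]
        · simp
        · intro i hi
          have : k ≠ i := by rintro rfl; exact hl.1 hi
          simp [this]
      have h2 : ∀ i ∈ l.toFinset, r k ^ c k * b i • orderedMonomial r l (c - Finsupp.single i 1)
          = (if i = k then a * c k else b i) • orderedMonomial r (k :: l) (c - Finsupp.single i 1) := by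
        intro i hi
        have : i ≠ k := by rintro rfl; exact hk hi
        rw [orderedMonomial_cons, mul_smul_comm, if_neg this]
        simp [this]
      rw [h1, Finset.sum_congr rfl h2, orderedMonomial_cons r k l (c + Finsupp.single j 1)]
      simp only [if_true, Finsupp.coe_add, Pi.add_apply, Finsupp.single_eq_of_ne (Ne.symm hjk), add_zero]
      abel

end OrderedMonomial

/-! ### The filtration generated by a vector -/

section Filtration

/-- If the `r j` move a filtration by at most `d` steps, then ordered monomials move it by at most
`d` times their degree. -/
theorem orderedMonomial_smul_mem_filtration {R ι M σ : Type*} [Ring R] [AddCommGroup M] [Module R M]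
    [SetLike σ M] (r : ι → R) (G : ℕ → σ) {d : ℕ} (hG : ∀ j t, ∀ u ∈ G t, r j • u ∈ G (t + d))
    (l : List ι) (c : ι →₀ ℕ) {u : M} {t : ℕ} (hu : u ∈ G t) :
    orderedMonomial r l c • u ∈ G (t + d * (l.map fun j => c j).sum) := by
  have hpow : ∀ (j : ι) (k t : ℕ) (u : M), u ∈ G t → r j ^ k • u ∈ G (t + d * k) := by
    intro j k
    induction k with
    | zero => intro t u hu; simpa using hu
    | succ k ih =>
      intro t u hu
      rw [pow_succ', mul_smul, mul_add, mul_one, ← add_assoc]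
      exact hG j _ _ (ih t u hu)
  induction l with
  | nil => simpa [orderedMonomial] using hu
  | cons k l ih =>
    rw [orderedMonomial_cons, mul_smul, List.map_cons, List.sum_cons, add_comm (c k), mul_add,
      ← add_assoc]
    exact hpow _ _ _ _ ih

variable {K R ι Q : Type*} [Field K] [Ring R] [Fintype ι]
  [AddCommGroup Q] [Module K Q] [Module R Q]

/-- The ordered monomial in all of the `r j`, in an arbitrarily chosen order of the indices. -/
noncomputable def stdMonomial (r : ι → R) (c : ι →₀ ℕ) : R :=
  orderedMonomial r Finset.univ.toList c

theorem stdMonomial_zero (r : ι → R) : stdMonomial r 0 = 1 := by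
  simp [stdMonomial, orderedMonomial]

theorem stdMonomial_smul_mem_filtration {σ : Type*} [SetLike σ Q] (r : ι → R) (G : ℕ → σ) {d : ℕ}
    (hG : ∀ j t, ∀ u ∈ G t, r j • u ∈ G (t + d)) (c : ι →₀ ℕ) {u : Q} {t : ℕ} (hu : u ∈ G t) :
    stdMonomial r c • u ∈ G (t + d * c.degree) := by
  have := orderedMonomial_smul_mem_filtration r G hG Finset.univ.toList c hu
  rwa [Finset.sum_map_toList, ← Finsupp.degree_eq_sum] at this

/-- The span of the vectors `r^c • v`, where `r^c` runs through the ordered monomials of degree at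
most `i`. -/
noncomputable def monomialSpan (K : Type*) [Field K] [Module K Q] (r : ι → R) (v : Q) (i : ℕ) :
    Submodule K Q :=
  Submodule.span K ((fun c => stdMonomial r c • v) '' {c | c.degree ≤ i})

theorem stdMonomial_smul_mem (r : ι → R) (v : Q) {i : ℕ} {c : ι →₀ ℕ} (h : c.degree ≤ i) :
    stdMonomial r c • v ∈ monomialSpan K r v i :=
  Submodule.subset_span ⟨c, h, rfl⟩

theorem self_mem_monomialSpan (r : ι → R) (v : Q) (i : ℕ) : v ∈ monomialSpan K r v i := by
  simpa [stdMonomial_zero] using stdMonomial_smul_mem (K := K) r v (c := 0) (i := i) (by simp)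

theorem monomialSpan_mono (r : ι → R) (v : Q) : Monotone (monomialSpan K r v) :=
  fun _ _ h => Submodule.span_mono (Set.image_mono fun _ hc => le_trans hc h)

theorem monomialSpan_eq_span_finset [DecidableEq Q] (r : ι → R) (v : Q) (i : ℕ) :
    monomialSpan K r v i = Submodule.span K
      ((boundedExponents ι i).image fun c => stdMonomial r c • v : Finset Q) := by
  rw [monomialSpan, Finset.coe_image]
  congr 2
  ext c
  simp

instance (r : ι → R) (v : Q) (i : ℕ) : FiniteDimensional K (monomialSpan K r v i) := by
  classical
  rw [monomialSpan_eq_span_finset]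
  infer_instance

variable [Algebra K R] [IsScalarTower K R Q]

theorem generator_mul_stdMonomial [DecidableEq ι] (r : ι → R)
    (h : ∀ j k, ∃ a : K, r j * r k = r k * r j + a • 1) (c : ι →₀ ℕ) (j : ι) :
    ∃ b : ι → K, r j * stdMonomial r c = stdMonomial r (c + Finsupp.single j 1)
      + ∑ k, b k • stdMonomial r (c - Finsupp.single k 1) := by
  have := generator_mul_orderedMonomial r h (Finset.nodup_toList Finset.univ) c (j := j) (by simp)
  rwa [Finset.toList_toFinset] at this

theorem generator_smul_mem (r : ι → R) (h : ∀ j k, ∃ a : K, r j * r k = r k * r j + a • 1)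
    (j : ι) {v u : Q} {i : ℕ} (hu : u ∈ monomialSpan K r v i) :
    r j • u ∈ monomialSpan K r v (i + 1) := by
  classical
  rw [monomialSpan] at hu
  induction hu using Submodule.span_induction with
  | mem u hu =>
    obtain ⟨c, hc, rfl⟩ := hu
    rw [Set.mem_ofPred_eq] at hc
    obtain ⟨b, hb⟩ := generator_mul_stdMonomial r h c j
    simp only [← mul_smul]
    rw [hb, add_smul, Finset.sum_smul]
    refine add_mem (stdMonomial_smul_mem r v (by simpa using hc)) (sum_mem fun k _ => ?_)
    rw [smul_assoc]
    refine Submodule.smul_mem _ _ (stdMonomial_smul_mem r v ?_)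
    exact (Finsupp.degree_mono tsub_le_self).trans (hc.trans (Nat.le_succ i))
  | zero => simp
  | add a b _ _ ha hb => rw [smul_add]; exact add_mem ha hb
  | smul a u _ hu =>
    rw [smul_algebra_smul_comm]
    exact Submodule.smul_mem _ _ hu

theorem span_generator_smul_mem (r : ι → R)
    (h : ∀ j k, ∃ a : K, r j * r k = r k * r j + a • 1) {z : R}
    (hz : z ∈ Submodule.span K (Set.range r)) {v u : Q} {i : ℕ}
    (hu : u ∈ monomialSpan K r v i) : z • u ∈ monomialSpan K r v (i + 1) := by
  induction hz using Submodule.span_induction with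
  | mem z hz => obtain ⟨j, rfl⟩ := hz; exact generator_smul_mem r h j hu
  | zero => simp
  | add a b _ _ ha hb => rw [add_smul]; exact add_mem ha hb
  | smul a u _ hu => rw [smul_assoc]; exact Submodule.smul_mem _ _ hu

theorem stdMonomial_smul_mem_of_mem (r : ι → R)
    (h : ∀ j k, ∃ a : K, r j * r k = r k * r j + a • 1) (c : ι →₀ ℕ) {v u : Q} {i : ℕ}
    (hu : u ∈ monomialSpan K r v i) : stdMonomial r c • u ∈ monomialSpan K r v (i + c.degree) := by
  have := stdMonomial_smul_mem_filtration r (monomialSpan K r v) (d := 1)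
    (fun j t u hu => generator_smul_mem r h j hu) c hu
  rwa [one_mul] at this

/-! ### Bernstein's inequality -/

/-- A finite family with scalar commutators whose commutator form is nondegenerate: every `r j` has
a dual `z` in the span of the family, which commutes with all `r k`, `k ≠ j`, while its commutator
with `r j` is a nonzero scalar. The generators of a Weyl algebra are an example. -/
structure IsWeylFamily (K : Type*) [Field K] [Algebra K R] (r : ι → R) : Prop where
  commutator : ∀ j k, ∃ a : K, r j * r k = r k * r j + a • 1
  dual : ∀ j, ∃ z ∈ Submodule.span K (Set.range r), ∃ ω : ι → K,
    (∀ k, ω k ≠ 0 ↔ k = j) ∧ ∀ k, z * r k = r k * z + ω k • 1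

/-- A combination of ordered monomials of degree at most `i` that annihilates the `i`-th piece of
the filtration is zero: commuting with the dual of `r j` differentiates the combination with
respect to `r j`. -/
theorem coeff_eq_zero_of_annihilates [CharZero K] {r : ι → R} (h : IsWeylFamily K r)
    {v : Q} (hv : v ≠ 0) (i : ℕ) (a : (ι →₀ ℕ) →₀ K) (ha : ∀ c ∈ a.support, c.degree ≤ i)
    (hann : ∀ u ∈ monomialSpan K r v i, (a.sum fun c t => t • stdMonomial r c) • u = 0) :
    a = 0 := by
  classical
  induction i generalizing a with
  | zero =>
    have h0 : a = Finsupp.single 0 (a 0) := by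
      ext c
      by_cases hc : c = 0
      · simp [hc]
      · rw [Finsupp.single_eq_of_ne hc]
        by_contra hac
        have := ha c (Finsupp.mem_support_iff.mpr hac)
        exact hc ((Finsupp.degree_eq_zero_iff c).mp (by omega))
    have h1 := hann v (self_mem_monomialSpan r v 0)
    rw [h0, Finsupp.sum_single_index (by simp), stdMonomial_zero, smul_assoc, one_smul] at h1
    rw [h0, (smul_eq_zero.mp h1).resolve_right hv, Finsupp.single_zero]
  | succ i ih =>
    have key : ∀ (j : ι) (c : ι →₀ ℕ), a (c + Finsupp.single j 1) = 0 := by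
      intro j
      obtain ⟨z, hz, ω, hω, hcomm⟩ := h.dual j
      have hωj : ω j ≠ 0 := (hω j).mpr rfl
      have hmul : ∀ c, z * stdMonomial r c = stdMonomial r c * z
          + (ω j * c j) • stdMonomial r (c - Finsupp.single j 1) := by
        intro c
        have h1 := mul_orderedMonomial r hcomm (Finset.nodup_toList Finset.univ) c
        rw [Finset.toList_toFinset, Finset.sum_eq_single_of_mem j (Finset.mem_univ j)] at h1
        · exact h1
        · intro k _ hk
          rw [not_not.mp (mt (hω k).mp hk), zero_mul, zero_smul]
      -- `b'` holds the coefficients of the commutator with the dual of `r j`, that is, of `ω j` times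
      -- the derivative with respect to `r j`.
      let b : (ι →₀ ℕ) →₀ K := Finsupp.comapDomain (fun c => c + Finsupp.single j 1) a
        (add_left_injective _).injOn
      let b' : (ι →₀ ℕ) →₀ K := Finsupp.onFinset b.support (fun c => ω j * (c j + 1 : ℕ) * b c)
        (fun c hc => Finsupp.mem_support_iff.mpr (right_ne_zero_of_mul hc))
      have hb' : b' = 0 := by
        refine ih b' (fun c hc => ?_) (fun u hu => ?_)
        · have h1 : b c ≠ 0 := right_ne_zero_of_mul (Finsupp.mem_support_iff.mp hc)
          have h2 : a (c + Finsupp.single j 1) ≠ 0 := h1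
          have h3 := ha _ (Finsupp.mem_support_iff.mpr h2)
          rw [map_add, Finsupp.degree_single] at h3
          omega
        · have h1 : (b'.sum fun c t => t • stdMonomial r c)
              = z * (a.sum fun c t => t • stdMonomial r c)
                - (a.sum fun c t => t • stdMonomial r c) * z := by
            have h2 : z * (a.sum fun c t => t • stdMonomial r c)
                - (a.sum fun c t => t • stdMonomial r c) * z
                = a.sum fun c t => (t * (ω j * c j)) • stdMonomial r (c - Finsupp.single j 1) := by
              rw [Finsupp.mul_sum, Finsupp.sum_mul, ← Finsupp.sum_sub]
              refine Finsupp.sum_congr fun c _ => ?_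
              rw [mul_smul_comm, smul_mul_assoc, hmul, smul_add, add_sub_cancel_left, smul_smul]
            rw [h2, Finsupp.sum, Finsupp.sum]
            refine Eq.trans ?_ (Finset.sum_filter_of_ne (p := fun c => c j ≠ 0) ?_)
            · refine Finset.sum_bij_ne_zero (fun c _ _ => c + Finsupp.single j 1) ?_ ?_ ?_ ?_
              · intro c hc _
                have h1 : b c ≠ 0 := right_ne_zero_of_mul (Finsupp.mem_support_iff.mp hc)
                have h2 : a (c + Finsupp.single j 1) ≠ 0 := h1
                simp [h2]
              · intro c _ _ c' _ _ hcc
                exact add_left_injective _ hcc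
              · intro c hc hne
                rw [Finset.mem_filter, Finsupp.mem_support_iff] at hc
                have hcc : c - Finsupp.single j 1 + Finsupp.single j 1 = c :=
                  tsub_add_cancel_of_le (by
                    rw [Finsupp.single_le_iff]; exact Nat.one_le_iff_ne_zero.mpr hc.2)
                have hval : b' (c - Finsupp.single j 1) ≠ 0 := by
                  change ω j * (((c - Finsupp.single j 1 : ι →₀ ℕ) j + 1 : ℕ) : K)
                    * a (c - Finsupp.single j 1 + Finsupp.single j 1) ≠ 0
                  rw [hcc]
                  exact mul_ne_zero (mul_ne_zero hωj (Nat.cast_ne_zero.mpr (Nat.succ_ne_zero _))) hc.1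
                refine ⟨c - Finsupp.single j 1, Finsupp.mem_support_iff.mpr hval, ?_, hcc⟩
                have h3 : b' (c - Finsupp.single j 1) = a c * (ω j * c j) := by
                  change ω j * (((c - Finsupp.single j 1 : ι →₀ ℕ) j + 1 : ℕ) : K)
                    * a (c - Finsupp.single j 1 + Finsupp.single j 1) = _
                  rw [hcc, mul_comm]
                  have : (c - Finsupp.single j 1 : ι →₀ ℕ) j + 1 = c j := by
                    simp; omega
                  rw [this]
                rw [h3]
                exact hne
              · intro c _ _
                change (ω j * ((c j + 1 : ℕ) : K) * a (c + Finsupp.single j 1)) • _ = _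
                rw [add_tsub_cancel_right, mul_comm (a _)]
                simp
            · intro c _ hne h0
              exact hne (by simp [h0])
          rw [h1, sub_smul, mul_smul, mul_smul,
            hann u (monomialSpan_mono r v (Nat.le_succ i) hu),
            hann _ (span_generator_smul_mem r h.commutator hz hu), smul_zero, sub_zero]
      intro c
      have h3 : ω j * (c j + 1 : ℕ) * a (c + Finsupp.single j 1) = 0 := DFunLike.congr_fun hb' c
      exact (mul_eq_zero.mp h3).resolve_left
        (mul_ne_zero hωj (Nat.cast_ne_zero.mpr (Nat.succ_ne_zero _)))
    refine ih a (fun c hc => ?_)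
      (fun u hu => hann u (monomialSpan_mono r v (Nat.le_succ i) hu))
    by_contra hdeg
    have hne : c ≠ 0 := by rintro rfl; simp at hdeg
    obtain ⟨j, hj⟩ := Finsupp.ne_iff.mp hne
    refine Finsupp.mem_support_iff.mp hc ?_
    rw [← key j (c - Finsupp.single j 1), tsub_add_cancel_of_le]
    rw [Finsupp.single_le_iff]
    exact Nat.one_le_iff_ne_zero.mpr (by simpa using hj)

/-- Bernstein's inequality: ordered monomials of degree at most `i` give linearly independent maps
from the `i`-th to the `2i`-th piece of the filtration. -/
theorem card_boundedExponents_le_finrank_mul [CharZero K] {r : ι → R} (h : IsWeylFamily K r)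
    {v : Q} (hv : v ≠ 0) (i : ℕ) :
    (boundedExponents ι i).card ≤ Module.finrank K (monomialSpan K r v i)
      * Module.finrank K (monomialSpan K r v (i + i)) := by
  classical
  let g : boundedExponents ι i → (monomialSpan K r v i →ₗ[K] monomialSpan K r v (i + i)) := fun c =>
    (Algebra.lsmul K K Q (stdMonomial r c.1)).restrict fun u hu =>
      monomialSpan_mono r v (Nat.add_le_add_left (mem_boundedExponents.mp c.2) i)
        (stdMonomial_smul_mem_of_mem r h.commutator c.1 hu)
  have hg : LinearIndependent K g := by
    rw [Fintype.linearIndependent_iff]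
    intro t ht c
    let a : (ι →₀ ℕ) →₀ K := Finsupp.onFinset (boundedExponents ι i)
      (fun c => if hc : c ∈ boundedExponents ι i then t ⟨c, hc⟩ else 0)
      (fun c hc => by by_contra h'; simp [h'] at hc)
    have hac : ∀ c : boundedExponents ι i, a c.1 = t c := fun c => by
      change (if hc : c.1 ∈ boundedExponents ι i then t ⟨c.1, hc⟩ else 0) = _
      rw [dif_pos c.2]
    have hsub : a.support ⊆ boundedExponents ι i := Finsupp.support_onFinset_subset
    have ha : a = 0 := by
      refine coeff_eq_zero_of_annihilates h hv i a
        (fun c hc => mem_boundedExponents.mp (hsub hc)) fun u hu => ?_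
      rw [Finsupp.sum_of_support_subset a hsub _ (by simp), ← Finset.sum_coe_sort, Finset.sum_smul]
      have h1 := congrArg Subtype.val (LinearMap.congr_fun ht ⟨u, hu⟩)
      simp only [LinearMap.sum_apply, LinearMap.smul_apply, Submodule.coe_sum, Submodule.coe_smul,
        LinearMap.zero_apply, Submodule.coe_zero] at h1
      rw [← h1]
      refine Finset.sum_congr rfl fun c _ => ?_
      rw [hac, smul_assoc]
      rfl
    rw [← hac, ha, Finsupp.zero_apply]
  have := hg.fintype_card_le_finrank
  rwa [Fintype.card_coe, Module.finrank_linearMap] at this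

end Filtration

/-! ### Standard exponents -/

section StandardExponents

/-- Vectors none of which lies in the span of those of smaller rank are linearly independent. -/
theorem linearIndependent_of_notMem_span_lt {K V α β : Type*} [Field K] [AddCommGroup V]
    [Module K V] [LinearOrder β] (f : α → V) {ρ : α → β} (hρ : Function.Injective ρ)
    (hf : ∀ a, f a ∉ Submodule.span K (f '' {b | ρ b < ρ a})) : LinearIndependent K f := by
  classical
  rw [linearIndependent_iff]
  intro t ht
  by_contra hne
  obtain ⟨a, ha, hmax⟩ := t.support.exists_max_image ρ (Finsupp.support_nonempty_iff.mpr hne)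
  have h0 : t a ≠ 0 := Finsupp.mem_support_iff.mp ha
  rw [Finsupp.linearCombination_apply, Finsupp.sum, ← Finset.add_sum_erase _ _ ha] at ht
  refine hf a ?_
  rw [← Submodule.smul_mem_iff _ h0, eq_neg_of_add_eq_zero_left ht]
  refine neg_mem (sum_mem fun b hb => Submodule.smul_mem _ _ (Submodule.subset_span ⟨b, ?_, rfl⟩))
  rw [Finset.mem_erase] at hb
  exact lt_of_le_of_ne (hmax b hb.2) (hρ.ne hb.1)

variable {K R ι Q : Type*} [Field K] [Ring R] [Fintype ι]
  [AddCommGroup Q] [Module K Q] [Module R Q]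

/-- The exponents `c` such that `r^c • v` is not a combination of the `r^c' • v` with `c'` smaller
than `c` in the given monomial order. -/
def standardExponents (K : Type*) [Field K] [Module K Q] (o : MonomialOrder ι) (r : ι → R) (v : Q) :
    Set (ι →₀ ℕ) :=
  {c | stdMonomial r c • v ∉
    Submodule.span K ((fun c' => stdMonomial r c' • v) '' {c' | o.toSyn c' < o.toSyn c})}

theorem linearIndependent_standardExponents (o : MonomialOrder ι) (r : ι → R) (v : Q) :
    LinearIndependent K fun c : standardExponents K o r v => stdMonomial r c.1 • v := by
  refine linearIndependent_of_notMem_span_lt _ (ρ := fun c => o.toSyn c.1)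
    (o.toSyn.injective.comp Subtype.val_injective) fun c hc => c.2 ?_
  refine Submodule.span_mono ?_ hc
  rintro _ ⟨b, hb, rfl⟩
  exact ⟨b.1, hb, rfl⟩

theorem span_standardExponents (o : MonomialOrder ι)
    (ho : ∀ a b : ι →₀ ℕ, o.toSyn a < o.toSyn b → a.degree ≤ b.degree) (r : ι → R) (v : Q) (i : ℕ) :
    monomialSpan K r v i = Submodule.span K
      ((fun c => stdMonomial r c • v) '' {c | c ∈ standardExponents K o r v ∧ c.degree ≤ i}) := by
  refine le_antisymm (Submodule.span_le.mpr ?_)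
    (Submodule.span_mono (Set.image_mono fun c hc => hc.2))
  rintro _ ⟨c, hc, rfl⟩
  rw [Set.mem_ofPred_eq] at hc
  induction hs : o.toSyn c using WellFoundedLT.induction generalizing c with
  | ind s ih =>
    subst hs
    by_cases hstd : c ∈ standardExponents K o r v
    · exact Submodule.subset_span ⟨c, ⟨hstd, hc⟩, rfl⟩
    · rw [standardExponents, Set.mem_ofPred_eq, not_not] at hstd
      refine Submodule.span_le.mpr ?_ hstd
      rintro _ ⟨c', hc', rfl⟩
      exact ih _ hc' c' ((ho _ _ hc').trans hc) rfl

/-- The number of standard exponents of degree at most `i` is the dimension of the `i`-th piece of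
the filtration. -/
theorem finrank_monomialSpan_eq_card
    (o : MonomialOrder ι)
    (ho : ∀ a b : ι →₀ ℕ, o.toSyn a < o.toSyn b → a.degree ≤ b.degree) (r : ι → R) (v : Q)
    [DecidablePred (· ∈ standardExponents K o r v)] (i : ℕ) :
    Module.finrank K (monomialSpan K r v i)
      = ((boundedExponents ι i).filter (· ∈ standardExponents K o r v)).card := by
  set s := (boundedExponents ι i).filter (· ∈ standardExponents K o r v) with hs
  have hmem : ∀ c, c ∈ s ↔ c ∈ standardExponents K o r v ∧ c.degree ≤ i := fun c => by
    rw [hs, Finset.mem_filter, mem_boundedExponents, and_comm]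
  have hli : LinearIndependent K fun c : s => stdMonomial r c.1 • v :=
    (linearIndependent_standardExponents o r v).comp
      (fun c : s => (⟨c.1, ((hmem _).mp c.2).1⟩ : standardExponents K o r v))
      fun a b hab => Subtype.ext (congrArg (fun c => c.1) hab)
  have himage : (fun c => stdMonomial r c • v) '' {c | c ∈ standardExponents K o r v ∧ c.degree ≤ i}
      = Set.range fun c : s => stdMonomial r c.1 • v := by
    ext u
    constructor
    · rintro ⟨c, hc, rfl⟩
      exact ⟨⟨c, (hmem c).mpr hc⟩, rfl⟩
    · rintro ⟨c, rfl⟩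
      exact ⟨c.1, (hmem _).mp c.2, rfl⟩
  rw [span_standardExponents o ho, himage, finrank_span_eq_card hli, Fintype.card_coe]

variable [Algebra K R] [IsScalarTower K R Q]

/-- Standard exponents are closed under passing to divisors, since the leading exponent of
`r j * r^c` is `c + e_j`. -/
theorem isLowerSet_standardExponents (o : MonomialOrder ι)
    (ho : ∀ a b : ι →₀ ℕ, a.degree < b.degree → o.toSyn a < o.toSyn b) (r : ι → R)
    (h : ∀ j k, ∃ a : K, r j * r k = r k * r j + a • 1) (v : Q) :
    IsLowerSet (standardExponents K o r v) := by
  classical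
  have step : ∀ (c : ι →₀ ℕ) (j : ι), c + Finsupp.single j 1 ∈ standardExponents K o r v →
      c ∈ standardExponents K o r v := by
    intro c j
    contrapose
    simp only [standardExponents, Set.mem_ofPred_eq, not_not]
    intro hc
    set T := Submodule.span K ((fun c' => stdMonomial r c' • v) ''
      {c' | o.toSyn c' < o.toSyn (c + Finsupp.single j 1)}) with hT
    have mem : ∀ c', o.toSyn c' < o.toSyn (c + Finsupp.single j 1) → stdMonomial r c' • v ∈ T :=
      fun c' hc' => Submodule.subset_span ⟨c', hc', rfl⟩
    have low : ∀ c' k, o.toSyn c' ≤ o.toSyn c → stdMonomial r (c' - Finsupp.single k 1) • v ∈ T := by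
      intro c' k hc'
      refine mem _ ((o.toSyn_monotone tsub_le_self).trans_lt (hc'.trans_lt (ho _ _ ?_)))
      rw [map_add, Finsupp.degree_single]
      exact Nat.lt_succ_self _
    have hmul : ∀ u ∈ Submodule.span K ((fun c' => stdMonomial r c' • v) ''
        {c' | o.toSyn c' < o.toSyn c}), r j • u ∈ T := by
      intro u hu
      induction hu using Submodule.span_induction with
      | mem u hu =>
        obtain ⟨c', hc', rfl⟩ := hu
        rw [Set.mem_ofPred_eq] at hc'
        obtain ⟨b, hb⟩ := generator_mul_stdMonomial r h c' j
        simp only [← mul_smul]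
        rw [hb, add_smul, Finset.sum_smul]
        refine add_mem (mem _ ?_) (sum_mem fun k _ => ?_)
        · rw [map_add, map_add]
          exact add_lt_add_left hc' _
        · rw [smul_assoc]
          exact Submodule.smul_mem _ _ (low _ _ hc'.le)
      | zero => simp
      | add a b _ _ ha hb => rw [smul_add]; exact add_mem ha hb
      | smul a u _ hu =>
        rw [smul_algebra_smul_comm]
        exact Submodule.smul_mem _ _ hu
    obtain ⟨b, hb⟩ := generator_mul_stdMonomial r h c j
    rw [← sub_eq_iff_eq_add] at hb
    rw [← hb, sub_smul, mul_smul, Finset.sum_smul]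
    refine sub_mem (hmul _ hc) (sum_mem fun k _ => ?_)
    rw [smul_assoc]
    exact Submodule.smul_mem _ _ (low _ _ le_rfl)
  intro c c' hle hc
  obtain ⟨e, rfl⟩ := exists_add_of_le hle
  clear hle
  induction e using Finsupp.induction_linear generalizing c' with
  | zero => simpa using hc
  | add e f he hf => exact he (hf (by rwa [add_assoc]))
  | single j k =>
    induction k with
    | zero => simpa using hc
    | succ k ih =>
      rw [Finsupp.single_add, ← add_assoc] at hc
      exact ih (step _ _ hc)

/-- A nonzero vector generates at least as many dimensions in degrees `≤ i` as there are exponents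
of degree `≤ i` in half the number of variables. If the standard exponents contain a coordinate
subspace of that dimension, this is clear; otherwise they are too few for Bernstein's inequality. -/
theorem card_boundedExponents_le_finrank [CharZero K] {r : ι → R} (h : IsWeylFamily K r)
    {κ : Type*} [Fintype κ] (hκ : Fintype.card ι = 2 * Fintype.card κ) {v : Q} (hv : v ≠ 0) (i : ℕ) :
    (boundedExponents κ i).card ≤ Module.finrank K (monomialSpan K r v i) := by
  classical
  let : LinearOrder ι := LinearOrder.lift' (Fintype.equivFin ι) (Fintype.equivFin ι).injective
  let o : MonomialOrder ι := MonomialOrder.degLex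
  have ho : ∀ a b : ι →₀ ℕ, a.degree < b.degree → o.toSyn a < o.toSyn b := fun a b hab =>
    MonomialOrder.degLex_lt_iff.mpr (Finsupp.DegLex.lt_iff.mpr (Or.inl hab))
  have ho' : ∀ a b : ι →₀ ℕ, o.toSyn a < o.toSyn b → a.degree ≤ b.degree := fun a b hab => by
    by_contra! hlt
    exact lt_asymm hab (ho b a hlt)
  set C := standardExponents K o r v with hCdef
  have hlow : IsLowerSet C := isLowerSet_standardExponents o ho r h.commutator v
  have hrank : ∀ i, Module.finrank K (monomialSpan K r v i)
      = ((boundedExponents ι i).filter (· ∈ C)).card := finrank_monomialSpan_eq_card o ho' r v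
  by_cases hS : ∃ S : Finset ι, S.card = Fintype.card κ ∧ ∀ c : ι →₀ ℕ, c.support ⊆ S → c ∈ C
  · obtain ⟨S, hcard, hSC⟩ := hS
    rw [hrank]
    have e : κ ≃ S := Fintype.equivOfCardEq (by rw [Fintype.card_coe, hcard])
    let f : κ ↪ ι := e.toEmbedding.trans (Function.Embedding.subtype _)
    refine Finset.card_le_card_of_injOn (fun c => Finsupp.embDomain f c) (fun c hc => ?_)
      (Finsupp.embDomain_injective f).injOn
    rw [Finset.mem_coe, mem_boundedExponents] at hc
    rw [Finset.mem_coe, Finset.mem_filter, mem_boundedExponents]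
    constructor
    · rwa [Finsupp.degree_apply, Finsupp.support_embDomain, Finset.sum_map,
        Finset.sum_congr rfl fun j _ => Finsupp.embDomain_apply_self f c j]
    · refine hSC _ fun j hj => ?_
      rw [Finsupp.support_embDomain, Finset.mem_map] at hj
      obtain ⟨k, _, rfl⟩ := hj
      exact (e k).2
  · exfalso
    push Not at hS
    obtain ⟨N, hN, hfew⟩ := exists_bound_of_isLowerSet hlow (Fintype.card κ) hS
    have h0 : (0 : ι →₀ ℕ) ∈ C := by
      have hpos : 0 < Module.finrank K (monomialSpan K r v 0) :=
        Module.finrank_pos_iff_exists_ne_zero.mpr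
          ⟨⟨v, self_mem_monomialSpan r v 0⟩, fun h0 => hv (congrArg Subtype.val h0)⟩
      rw [hrank, Finset.card_pos] at hpos
      obtain ⟨c, hc⟩ := hpos
      exact hlow (zero_le (a := c)) (Finset.mem_filter.mp hc).2
    -- The exponent `0` is standard and has fewer than `card κ` large coordinates, so `card κ > 0`.
    obtain ⟨m, hm⟩ := Nat.exists_eq_add_of_le' (Nat.zero_lt_of_lt (hfew 0 h0))
    rw [hm] at hfew hκ
    set A := 2 ^ Fintype.card ι * N ^ Fintype.card ι with hA
    have hbound : ∀ i, Module.finrank K (monomialSpan K r v i) ≤ A * (i + 1) ^ m := fun i => by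
      rw [hrank]
      refine card_le_of_few_large hN _ (fun c hc => ?_) fun c hc => ?_
      · exact mem_boundedExponents.mp (Finset.mem_filter.mp hc).1
      · exact Nat.lt_succ_iff.mp (hfew c (Finset.mem_filter.mp hc).2)
    -- The two bounds on the growth force `(i + 1) ^ 2` to be bounded.
    set B := A * (A * 2 ^ m) * (Fintype.card ι).factorial with hB
    have hcontra : ∀ i, (i + 1) ^ 2 ≤ B := by
      intro i
      have h1 := (pow_le_card_boundedExponents ι i).trans (Nat.mul_le_mul_right _
        ((card_boundedExponents_le_finrank_mul h hv i).trans
          (Nat.mul_le_mul (hbound i) (hbound (i + i)))))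
      have h2 : (i + i + 1) ^ m ≤ 2 ^ m * (i + 1) ^ m := by
        rw [← mul_pow]
        exact Nat.pow_le_pow_left (by omega) m
      have h3 : (i + 1) ^ 2 * ((i + 1) ^ m * (i + 1) ^ m) ≤ B * ((i + 1) ^ m * (i + 1) ^ m) := by
        calc (i + 1) ^ 2 * ((i + 1) ^ m * (i + 1) ^ m) = (i + 1) ^ Fintype.card ι := by
              rw [hκ]; ring
          _ ≤ _ := h1
          _ ≤ A * (i + 1) ^ m * (A * (2 ^ m * (i + 1) ^ m)) * (Fintype.card ι).factorial := by
              gcongr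
          _ = _ := by rw [hB]; ring
      exact Nat.le_of_mul_le_mul_right h3 (by positivity)
    have := hcontra B
    nlinarith

end StandardExponents

/-! ### Length of filtered modules -/

section Length

variable {K R ι A : Type*} [Field K] [CharZero K] [Ring R] [Algebra K R] [Fintype ι]
  [AddCommGroup A] [Module K A] [Module R A] [IsScalarTower K R A]

/-- Passing from a submodule `N` to a strictly larger one `N'` raises the dimension of the pieces of
a filtration at least as fast as the cyclic submodule of `A ⧸ N` generated by an element of `N'`
grows. -/
theorem finrank_inf_add_card_le {r : ι → R} (h : IsWeylFamily K r)
    {κ : Type*} [Fintype κ] (hκ : Fintype.card ι = 2 * Fintype.card κ)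
    {G : ℕ → Submodule K A} (hmono : Monotone G) [∀ t, FiniteDimensional K (G t)] {d : ℕ}
    (hG : ∀ j t, ∀ a ∈ G t, r j • a ∈ G (t + d)) {N N' : Submodule R A} (hle : N ≤ N') {v : A}
    (hv' : v ∈ N') (hv : v ∉ N) {s : ℕ} (hs : v ∈ G s) (i : ℕ) :
    Module.finrank K ↥(N.restrictScalars K ⊓ G (s + d * i)) + (boundedExponents κ i).card
      ≤ Module.finrank K ↥(N'.restrictScalars K ⊓ G (s + d * i)) := by
  set H := G (s + d * i) with hH
  have : FiniteDimensional K ↥(N'.restrictScalars K ⊓ H) :=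
    Submodule.finiteDimensional_inf_right _ _
  let φ : ↥(N'.restrictScalars K ⊓ H) →ₗ[K] A ⧸ N :=
    (N.mkQ.restrictScalars K).domRestrict (N'.restrictScalars K ⊓ H)
  have hrange : monomialSpan K r (N.mkQ v) i ≤ LinearMap.range φ := by
    refine Submodule.span_le.mpr ?_
    rintro _ ⟨c, hc, rfl⟩
    rw [Set.mem_ofPred_eq] at hc
    refine ⟨⟨stdMonomial r c • v, N'.smul_mem _ hv', ?_⟩, map_smul N.mkQ _ _⟩
    exact hmono (Nat.add_le_add_left (Nat.mul_le_mul_left d hc) s)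
      (stdMonomial_smul_mem_filtration r G hG c hs)
  have hker : (N.restrictScalars K ⊓ H).comap (N'.restrictScalars K ⊓ H).subtype
      ≤ LinearMap.ker φ := fun a ha =>
    (Submodule.Quotient.mk_eq_zero N).mpr ha.1
  have hle' : N.restrictScalars K ⊓ H ≤ N'.restrictScalars K ⊓ H := inf_le_inf_right _ hle
  have h1 := card_boundedExponents_le_finrank h hκ (v := N.mkQ v)
    (fun h0 => hv ((Submodule.Quotient.mk_eq_zero N).mp h0)) i
  have h2 := Submodule.finrank_mono hrange
  have h3 := Submodule.finrank_mono hker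
  rw [(Submodule.comapSubtypeEquivOfLe hle').finrank_eq] at h3
  have h4 := LinearMap.finrank_range_add_finrank_ker φ
  omega

/-- A module over an algebra generated by a Weyl family of `2m` elements that move a filtration by
at most `d` has length at most `d ^ m`, if the pieces of the filtration are no larger than those of
the polynomial algebra in `m` variables. -/
theorem length_le_pow_of_filtration {r : ι → R} (h : IsWeylFamily K r)
    {κ : Type*} [Fintype κ] (hκ : Fintype.card ι = 2 * Fintype.card κ)
    {G : ℕ → Submodule K A} (hmono : Monotone G) (hexh : ∀ a, ∃ t, a ∈ G t)
    [∀ t, FiniteDimensional K (G t)] {d : ℕ} (hG : ∀ j t, ∀ a ∈ G t, r j • a ∈ G (t + d))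
    (hdim : ∀ t, Module.finrank K (G t) ≤ (boundedExponents κ t).card) :
    Module.length R A ≤ ((d ^ Fintype.card κ : ℕ) : ℕ∞) := by
  rw [← WithBot.coe_le_coe, Module.coe_length, Order.krullDim]
  refine iSup_le fun p => ?_
  suffices hp : p.length ≤ d ^ Fintype.card κ by exact_mod_cast hp
  have hstep : ∀ j : Fin p.length, ∃ v ∈ p j.succ, v ∉ p j.castSucc := fun j =>
    SetLike.exists_of_lt (p.step j)
  choose v hv' hv using hstep
  choose t ht using fun j => hexh (v j)
  obtain ⟨s, hs⟩ : ∃ s, ∀ j, v j ∈ G s :=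
    ⟨Finset.univ.sup t, fun j => hmono (Finset.le_sup (Finset.mem_univ j)) (ht j)⟩
  have hdimp : ∀ i, p.length * (boundedExponents κ i).card
      ≤ (boundedExponents κ (s + d * i)).card := by
    intro i
    have hind : ∀ j : Fin (p.length + 1), (j : ℕ) * (boundedExponents κ i).card
        ≤ Module.finrank K ↥((p j).restrictScalars K ⊓ G (s + d * i)) := by
      intro j
      induction j using Fin.induction with
      | zero => simp
      | succ j ih =>
        have h1 := finrank_inf_add_card_le h hκ hmono hG (p.step j).le (hv' j) (hv j) (hs j) i
        rw [Fin.val_succ, add_mul, one_mul]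
        rw [Fin.val_castSucc] at ih
        exact (Nat.add_le_add_right ih _).trans h1
    exact (hind (Fin.last _)).trans ((Submodule.finrank_mono inf_le_right).trans (hdim _))
  refine le_pow_of_forall_mul_pow_le (q := s + Fintype.card κ) fun t ht => ?_
  obtain ⟨i, rfl⟩ := Nat.exists_eq_add_of_le' ht
  calc p.length * (i + 1) ^ Fintype.card κ
      ≤ p.length * ((boundedExponents κ i).card * (Fintype.card κ).factorial) :=
        Nat.mul_le_mul_left _ (pow_le_card_boundedExponents κ i)
    _ = p.length * (boundedExponents κ i).card * (Fintype.card κ).factorial := by ring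
    _ ≤ (boundedExponents κ (s + d * i)).card * (Fintype.card κ).factorial :=
        Nat.mul_le_mul_right _ (hdimp i)
    _ ≤ (s + d * i + Fintype.card κ) ^ Fintype.card κ := card_boundedExponents_le_pow κ _
    _ ≤ (d * (i + 1) + (s + Fintype.card κ)) ^ Fintype.card κ := by
        refine Nat.pow_le_pow_left ?_ _
        rw [mul_add]
        omega

end Length

/-! ### The Weyl algebra -/

namespace Weyl

variable {K : Type*} [Field K] {n : ℕ}

/-- The generators `x_i` and `∂_i` of the Weyl algebra as one family. -/
noncomputable def generator : Fin n ⊕ Fin n → WeylAlgebra K n := Sum.elim x d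

variable (K) in
/-- The commutator form on the generators: `[∂_i, x_i] = 1` and `[x_i, ∂_i] = -1`. -/
def generatorForm : Fin n ⊕ Fin n → Fin n ⊕ Fin n → K
  | Sum.inr i, Sum.inl j => if i = j then 1 else 0
  | Sum.inl i, Sum.inr j => if i = j then -1 else 0
  | _, _ => 0

theorem x_mul_x (i j : Fin n) : (x i * x j : WeylAlgebra K n) = x j * x i :=
  toEnd_injective (LinearMap.ext fun p => by
    change toEnd (x i) (toEnd (x j) p) = toEnd (x j) (toEnd (x i) p)
    simp only [coe_x_apply]
    ring)

theorem d_mul_d (i j : Fin n) : (d i * d j : WeylAlgebra K n) = d j * d i := by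
  have h1 : ∀ k : Fin n, (d k : WeylAlgebra K n) = dPow K (Finsupp.single k 1) := fun k => by
    have := d_mul_dPow (K := K) k 0
    rwa [zero_add, show dPow K (0 : Fin n →₀ ℕ) = (1 : WeylAlgebra K n) by simp [dPow], mul_one] at this
  rw [h1 j, d_mul_dPow, add_comm, ← d_mul_dPow, ← h1 i, ← h1 j]

theorem d_mul_x (i j : Fin n) :
    (d i * x j : WeylAlgebra K n) = x j * d i + (if i = j then 1 else 0 : K) • 1 :=
  toEnd_injective (LinearMap.ext fun p => by
    change toEnd (d i) (toEnd (x j) p)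
      = toEnd (x j) (toEnd (d i) p) + (if i = j then 1 else 0 : K) • p
    simp only [coe_x_apply, coe_d_apply, Derivation.leibniz, smul_eq_mul, MvPolynomial.pderiv_X,
      Pi.single_apply]
    split_ifs <;> simp_all)

theorem generator_mul_generator (a b : Fin n ⊕ Fin n) :
    (generator a * generator b : WeylAlgebra K n)
      = generator b * generator a + generatorForm K a b • 1 := by
  rcases a with i | i <;> rcases b with j | j
  · simpa [generator, generatorForm] using x_mul_x (K := K) i j
  · simp only [generator, generatorForm, Sum.elim_inl, Sum.elim_inr]
    rw [d_mul_x]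
    by_cases hij : i = j
    · subst hij; simp
    · simp [hij, Ne.symm hij]
  · simpa [generator, generatorForm] using d_mul_x (K := K) i j
  · simpa [generator, generatorForm] using d_mul_d (K := K) i j

theorem generatorForm_swap_ne_zero (a b : Fin n ⊕ Fin n) :
    generatorForm K a.swap b ≠ 0 ↔ b = a := by
  rcases a with i | i <;> rcases b with j | j <;> simp [generatorForm, eq_comm]

theorem generatorForm_ne_zero_swap (a b : Fin n ⊕ Fin n) :
    generatorForm K b a.swap ≠ 0 ↔ b = a := by
  rcases a with i | i <;> rcases b with j | j <;> simp [generatorForm]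

/-! ### The Bernstein filtration -/

variable (K n) in
/-- The elements of degree at most `t`. -/
noncomputable def degreeLE (t : ℕ) : Submodule K (WeylAlgebra K n) :=
  Submodule.span K (xdMonomial K '' {p | p.1.degree + p.2.degree ≤ t})

theorem degreeLE_mono : Monotone (degreeLE K n) := fun _ _ h =>
  Submodule.span_mono (Set.image_mono fun _ hp => le_trans hp h)

theorem xdMonomial_mem_degreeLE {p : (Fin n →₀ ℕ) × (Fin n →₀ ℕ)} {t : ℕ}
    (h : p.1.degree + p.2.degree ≤ t) : xdMonomial K p ∈ degreeLE K n t :=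
  Submodule.subset_span ⟨p, h, rfl⟩

theorem degreeLE_eq_span_finset [DecidableEq (WeylAlgebra K n)] (t : ℕ) :
    degreeLE K n t = Submodule.span K ((boundedExponents (Fin n ⊕ Fin n) t).image
      fun c => xdMonomial K (Finsupp.sumFinsuppEquivProdFinsupp c) : Finset (WeylAlgebra K n)) := by
  rw [degreeLE, Finset.coe_image]
  congr 1
  have hdeg : ∀ c : Fin n ⊕ Fin n →₀ ℕ, (Finsupp.sumFinsuppEquivProdFinsupp c).1.degree
      + (Finsupp.sumFinsuppEquivProdFinsupp c).2.degree = c.degree := fun c => by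
    simp only [Finsupp.degree_eq_sum, Fintype.sum_sum_type]
    simp
  ext a
  constructor
  · rintro ⟨p, hp, rfl⟩
    refine ⟨Finsupp.sumFinsuppEquivProdFinsupp.symm p, ?_, by simp⟩
    rw [Finset.mem_coe, mem_boundedExponents, ← hdeg, Equiv.apply_symm_apply]
    exact hp
  · rintro ⟨c, hc, rfl⟩
    rw [Finset.mem_coe, mem_boundedExponents, ← hdeg] at hc
    exact ⟨_, hc, rfl⟩

instance (t : ℕ) : FiniteDimensional K (degreeLE K n t) := by
  classical
  rw [degreeLE_eq_span_finset]
  infer_instance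

theorem finrank_degreeLE_le (t : ℕ) :
    Module.finrank K (degreeLE K n t) ≤ (boundedExponents (Fin n ⊕ Fin n) t).card := by
  classical
  rw [degreeLE_eq_span_finset]
  exact (finrank_span_finset_le_card _).trans Finset.card_image_le

theorem exists_mem_degreeLE (a : WeylAlgebra K n) : ∃ t, a ∈ degreeLE K n t := by
  have ha := xdMonomial_span (Submodule.mem_top (x := a))
  induction ha using Submodule.span_induction with
  | mem a ha => obtain ⟨p, rfl⟩ := ha; exact ⟨_, xdMonomial_mem_degreeLE le_rfl⟩
  | zero => exact ⟨0, zero_mem _⟩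
  | add a b _ _ ha hb =>
    obtain ⟨s, hs⟩ := ha
    obtain ⟨t, ht⟩ := hb
    exact ⟨max s t, add_mem (degreeLE_mono (le_max_left _ _) hs)
      (degreeLE_mono (le_max_right _ _) ht)⟩
  | smul c a _ ha => obtain ⟨t, ht⟩ := ha; exact ⟨t, Submodule.smul_mem _ _ ht⟩

theorem x_mul_mem_degreeLE (i : Fin n) (t : ℕ) (a : WeylAlgebra K n) (ha : a ∈ degreeLE K n t) :
    (x i : WeylAlgebra K n) • a ∈ degreeLE K n (t + 1) := by
  rw [smul_eq_mul]
  induction ha using Submodule.span_induction with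
  | mem a ha =>
    obtain ⟨p, hp, rfl⟩ := ha
    rw [Set.mem_ofPred_eq] at hp
    rw [xdMonomial, ← mul_assoc, x_mul_xPow]
    refine xdMonomial_mem_degreeLE (p := (Finsupp.single i 1 + p.1, p.2)) ?_
    simp only [map_add, Finsupp.degree_single]
    omega
  | zero => rw [mul_zero]; exact zero_mem _
  | add a b _ _ ha hb => rw [mul_add]; exact add_mem ha hb
  | smul c a _ ha => rw [mul_smul_comm]; exact Submodule.smul_mem _ _ ha

theorem d_mul_mem_degreeLE (i : Fin n) (t : ℕ) (a : WeylAlgebra K n) (ha : a ∈ degreeLE K n t) :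
    (d i : WeylAlgebra K n) • a ∈ degreeLE K n (t + 1) := by
  rw [smul_eq_mul]
  induction ha using Submodule.span_induction with
  | mem a ha =>
    obtain ⟨p, hp, rfl⟩ := ha
    rw [Set.mem_ofPred_eq] at hp
    rw [xdMonomial, ← mul_assoc, d_mul_xPow, add_mul, mul_assoc, d_mul_dPow, smul_mul_assoc]
    refine add_mem (xdMonomial_mem_degreeLE (p := (p.1, p.2 + Finsupp.single i 1)) ?_)
      (Submodule.smul_mem _ _ (xdMonomial_mem_degreeLE (p := (p.1 - Finsupp.single i 1, p.2)) ?_))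
    · simp only [map_add, Finsupp.degree_single]
      omega
    · have : (p.1 - Finsupp.single i 1).degree ≤ p.1.degree := Finsupp.degree_mono tsub_le_self
      change (p.1 - Finsupp.single i 1).degree + p.2.degree ≤ t + 1
      omega
  | zero => rw [mul_zero]; exact zero_mem _
  | add a b _ _ ha hb => rw [mul_add]; exact add_mem ha hb
  | smul c a _ ha => rw [mul_smul_comm]; exact Submodule.smul_mem _ _ ha

theorem mul_mem_degreeLE {s t : ℕ} {a b : WeylAlgebra K n} (ha : a ∈ degreeLE K n s)
    (hb : b ∈ degreeLE K n t) : a * b ∈ degreeLE K n (t + s) := by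
  have hsum : ∀ c : Fin n →₀ ℕ, ((List.finRange n).map fun j => c j).sum = c.degree := fun c => by
    rw [Finsupp.degree_eq_sum, ← List.ofFn_eq_map, List.sum_ofFn]
  induction ha using Submodule.span_induction with
  | mem a ha =>
    obtain ⟨p, hp, rfl⟩ := ha
    have h1 := orderedMonomial_smul_mem_filtration (x (K := K) (n := n)) (degreeLE K n)
      x_mul_mem_degreeLE (List.finRange n) p.1
      (orderedMonomial_smul_mem_filtration (d (K := K) (n := n)) (degreeLE K n)
        d_mul_mem_degreeLE (List.finRange n) p.2 hb)
    rw [smul_eq_mul, smul_eq_mul, ← mul_assoc, hsum, hsum, one_mul, one_mul] at h1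
    refine degreeLE_mono ?_ h1
    rw [Set.mem_ofPred_eq] at hp
    omega
  | zero => rw [zero_mul]; exact zero_mem _
  | add a a' _ _ ha ha' => rw [add_mul]; exact add_mem ha ha'
  | smul c a _ ha => rw [smul_mul_assoc]; exact Submodule.smul_mem _ _ ha

theorem mem_degreeLE_of_deg_le [CharZero K] {a : WeylAlgebra K n} {t : ℕ}
    (h : deg a ≤ (t : WithBot ℕ)) : a ∈ degreeLE K n t := by
  rw [← (xdBasis K n).linearCombination_repr a, Finsupp.linearCombination_apply]
  refine sum_mem fun p hp => Submodule.smul_mem _ _ ?_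
  rw [xdBasis, Module.Basis.mk_apply]
  refine xdMonomial_mem_degreeLE ?_
  exact_mod_cast (Finset.le_sup (f := fun p : (Fin n →₀ ℕ) × (Fin n →₀ ℕ) =>
    ((p.1.degree + p.2.degree : ℕ) : WithBot ℕ)) hp).trans h

theorem map_generator_mem_degreeLE [CharZero K] (σ : WeylAlgebra K n →ₐ[K] WeylAlgebra K n)
    (a : Fin n ⊕ Fin n) : σ (generator a) ∈ degreeLE K n (endDeg σ) := by
  have hle : ∀ i : Fin n, deg (σ (x i)) ⊔ deg (σ (d i)) ≤ (endDeg σ : WithBot ℕ) := fun i =>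
    (Finset.le_sup (f := fun i : Fin n => deg (σ (x i)) ⊔ deg (σ (d i)))
      (Finset.mem_univ i)).trans (WithBot.le_coe_unbotD _ _)
  rcases a with i | i
  · exact mem_degreeLE_of_deg_le (le_sup_left.trans (hle i))
  · exact mem_degreeLE_of_deg_le (le_sup_right.trans (hle i))

/-! ### The bimodule structure -/

attribute [local instance] TensorProduct.Algebra.module

theorem isScalarTower_bimodule {A : Type*} [Ring A] [Algebra K A] (B : Subalgebra K A) :
    IsScalarTower K (B ⊗[K] B.op) A :=
  ⟨fun c t a => LinearMap.congr_fun
    (map_smul (TensorProduct.Algebra.moduleAux : B ⊗[K] B.op →ₗ[K] A →ₗ[K] A) c t) a⟩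

/-- The left multiplications by `σ(x_i)`, `σ(∂_i)` and the right multiplications by these elements,
as elements of `B ⊗ Bᵒᵖ` for the image `B` of `σ`. -/
noncomputable def bimoduleGenerator (σ : WeylAlgebra K n →ₐ[K] WeylAlgebra K n) :
    (Fin n ⊕ Fin n) ⊕ (Fin n ⊕ Fin n) → σ.range ⊗[K] σ.range.op :=
  Sum.elim (fun a => σ.rangeRestrict (generator a) ⊗ₜ 1)
    (fun a => 1 ⊗ₜ ⟨MulOpposite.op (σ (generator a)), ⟨generator a, rfl⟩⟩)

theorem isWeylFamily_bimoduleGenerator (σ : WeylAlgebra K n →ₐ[K] WeylAlgebra K n) :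
    IsWeylFamily K (bimoduleGenerator σ) := by
  -- Right multiplications compose in the opposite order, which transposes the commutator form.
  let Ω : (Fin n ⊕ Fin n) ⊕ (Fin n ⊕ Fin n) → (Fin n ⊕ Fin n) ⊕ (Fin n ⊕ Fin n) → K := fun j k =>
    Sum.elim (fun a => Sum.elim (fun b => generatorForm K a b) 0 k)
      (fun a => Sum.elim 0 (fun b => generatorForm K b a) k) j
  have hΩ : ∀ j k, bimoduleGenerator σ j * bimoduleGenerator σ k
      = bimoduleGenerator σ k * bimoduleGenerator σ j + Ω j k • 1 := by
    rintro (a | a) (b | b)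
    · simp only [bimoduleGenerator, Sum.elim_inl, Algebra.TensorProduct.tmul_mul_tmul, Ω,
        Algebra.TensorProduct.one_def, ← map_mul, mul_one, TensorProduct.smul_tmul']
      rw [generator_mul_generator a b, map_add, map_smul, map_one, TensorProduct.add_tmul]
    · simp [bimoduleGenerator, Ω]
    · simp [bimoduleGenerator, Ω]
    · have h1 : σ (generator b) * σ (generator a)
          = σ (generator a) * σ (generator b) + generatorForm K b a • 1 := by
        rw [← map_mul, generator_mul_generator b a, map_add, map_mul, map_smul, map_one]
      simp only [bimoduleGenerator, Sum.elim_inr, Algebra.TensorProduct.tmul_mul_tmul, Ω,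
        Algebra.TensorProduct.one_def, mul_one, ← TensorProduct.tmul_smul, ← TensorProduct.tmul_add]
      congr 1
      exact Subtype.ext (congrArg MulOpposite.op h1)
  refine ⟨fun j k => ⟨_, hΩ j k⟩, fun j => ⟨bimoduleGenerator σ (Sum.map Sum.swap Sum.swap j),
    Submodule.subset_span ⟨_, rfl⟩, Ω (Sum.map Sum.swap Sum.swap j), fun k => ?_,
    fun k => hΩ _ k⟩⟩
  rcases j with a | a <;> rcases k with b | b
  · simpa [Ω] using generatorForm_swap_ne_zero (K := K) a b
  · simp [Ω]
  · simp [Ω]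
  · simpa [Ω] using generatorForm_ne_zero_swap (K := K) a b

theorem bimoduleGenerator_smul_mem_degreeLE [CharZero K]
    (σ : WeylAlgebra K n →ₐ[K] WeylAlgebra K n) (j : (Fin n ⊕ Fin n) ⊕ (Fin n ⊕ Fin n)) (t : ℕ)
    (a : WeylAlgebra K n) (ha : a ∈ degreeLE K n t) :
    bimoduleGenerator σ j • a ∈ degreeLE K n (t + endDeg σ) := by
  rcases j with b | b
  · have : bimoduleGenerator σ (Sum.inl b) • a = σ (generator b) * (a * 1) := rfl
    rw [this, mul_one]
    exact mul_mem_degreeLE (map_generator_mem_degreeLE σ b) ha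
  · have : bimoduleGenerator σ (Sum.inr b) • a = 1 * (a * σ (generator b)) := rfl
    rw [this, one_mul, add_comm]
    exact mul_mem_degreeLE ha (map_generator_mem_degreeLE σ b)

end Weyl

theorem mainTheorem2 {K : Type*} [Field K] [CharZero K] (n : ℕ)
    (σ : Weyl.WeylAlgebra K n →ₐ[K] Weyl.WeylAlgebra K n) :
    Weyl.bimoduleLength σ.range ≤ ((Weyl.endDeg σ ^ (2 * n) : ℕ) : ℕ∞) := by
  let _ : Module (σ.range ⊗[K] σ.range.op) (Weyl.WeylAlgebra K n) := TensorProduct.Algebra.module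
  have : IsScalarTower K (σ.range ⊗[K] σ.range.op) (Weyl.WeylAlgebra K n) :=
    Weyl.isScalarTower_bimodule σ.range
  have hcard : Fintype.card (Fin n ⊕ Fin n) = 2 * n := by simp [two_mul]
  have := length_le_pow_of_filtration (Weyl.isWeylFamily_bimoduleGenerator σ)
    (κ := Fin n ⊕ Fin n) (by rw [Fintype.card_sum, two_mul]) Weyl.degreeLE_mono
    Weyl.exists_mem_degreeLE (Weyl.bimoduleGenerator_smul_mem_degreeLE σ) Weyl.finrank_degreeLE_le
  rwa [hcard] at this
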